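/- For a normed space $X$, let $b(X)$ denote its Borsuk number: the minimum $k$ such that every bounded subset $S\subseteq X$ with at least two points can be partitioned into $k$ (possibly empty) parts, each of diameter strictly smaller than that of $S$. Let $\ell_p^d$ denote $\mathbb{R}^d$ with the norm $\|x\|_p=(\sum_{i=1}^d|x_i|^p)^{1/p}$ for real $p\ge 1$, and $\|x\|_\infty=\max_i|x_i|$ for $p=\infty$. Then for every $p\ge 2.81$ (real or $p=\infty$), $$b(\ell_p^{406})\ge 422.$$ -/

import Mathlib

open scoped ENNReal

/-- The set `S` can be partitioned into `k` parts of smaller diameter. The parts are pairwise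
disjoint and their union is `S`; as usual, some of them may be empty (so that `k` means
"at most `k` nonempty parts"). -/
def HasBorsukPartition {X : Type*} [MetricSpace X] (S : Set X) (k : ℕ) : Prop :=
  ∃ P : Fin k → Set X,
    (⋃ i, P i) = S ∧ (∀ i j, i ≠ j → Disjoint (P i) (P j)) ∧
      ∀ i, Metric.diam (P i) < Metric.diam S

/-- The Borsuk number of a metric space: the minimum `k` such that every bounded set with at least
two points can be partitioned into `k` parts of smaller diameter (`⊤` if there is no such `k`). -/
noncomputable def borsukNumber (X : Type*) [MetricSpace X] : ℕ∞ :=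
  sInf {b : ℕ∞ | ∃ k : ℕ, b = (k : ℕ∞) ∧
    ∀ S : Set X, Bornology.IsBounded S → S.Nontrivial → HasBorsukPartition S k}

/-- The space `ℝ ^ d` with the `ℓ_p`-norm. -/
abbrev lpSpace (p : ℝ≥0∞) (d : ℕ) : Type := PiLp p (fun _ : Fin d => ℝ)

/-! For finite `p`, map each 9-subset of a 29-set to a vector indexed by the 406 pairs, via
`pairValue`. The distance depends only on `h = |A \ B|` and, once `2 ^ p ≥ 7`, is largest at `h =
5`, i.e. at intersection size 4. A part of smaller diameter thus avoids that size, so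
`card_le_choose_four` bounds it by `C(29,4)`. Since `421 * C(29,4) < C(29,9)`, 421 parts do not
suffice. For `p = ∞` a 9-cube does. -/

open Finset in
/-- A family of sets whose sizes are `4` mod `5` and whose pairwise intersections never have size
`4` mod `5` has at most `n.choose 4` members. -/
theorem card_le_choose_four {n : ℕ} (F : Finset (Finset (Fin n)))
    (hF : ∀ A ∈ F, A.card % 5 = 4)
    (hint : ∀ A ∈ F, ∀ B ∈ F, A ≠ B → (A ∩ B).card % 5 ≠ 4) : F.card ≤ n.choose 4 := by
  have : Fact (Nat.Prime 5) := ⟨by norm_num⟩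
  let M : Matrix F (powersetCard 4 (univ : Finset (Fin n))) (ZMod 5) :=
    fun A S => if S.1 ⊆ A.1 then 1 else 0
  -- Lucas: this makes the Gram matrix of the inclusion matrix `M` the identity over `ZMod 5`, so
  -- its rank is `F.card`.
  have hchoose : ∀ m : ℕ, ((m.choose 4 : ℕ) : ZMod 5) = if m % 5 = 4 then 1 else 0 := by
    intro m
    have h := Choose.choose_modEq_choose_mod_mul_choose_div_nat (n := m) (k := 4) (p := 5)
    have h' := (ZMod.natCast_eq_natCast_iff _ _ _).2 h
    rw [h']
    have hlt : m % 5 < 5 := Nat.mod_lt _ (by norm_num)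
    generalize m % 5 = r at hlt ⊢
    norm_num
    interval_cases r <;> simp [Nat.choose]
  have hentry : ∀ A B : F, (M * M.transpose) A B = (((A.1 ∩ B.1).card.choose 4 : ℕ) : ZMod 5) := by
    intro A B
    have hset : powersetCard 4 (A.1 ∩ B.1) =
        {S ∈ powersetCard 4 (univ : Finset (Fin n)) | S ⊆ A.1 ∧ S ⊆ B.1} := by
      ext S
      simp [mem_powersetCard, subset_inter_iff, and_comm]
    rw [Matrix.mul_apply, ← card_powersetCard, hset, ← sum_boole]
    refine (sum_congr rfl fun S _ => ?_).trans (sum_coe_sort (powersetCard 4 univ)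
      fun S => if S ⊆ A.1 ∧ S ⊆ B.1 then (1 : ZMod 5) else 0)
    rw [Matrix.transpose_apply]
    simp only [M, ite_and]
    split_ifs <;> simp
  have hone : M * M.transpose = 1 := by
    ext A B
    rw [hentry, hchoose]
    by_cases hAB : A = B
    · subst hAB
      simp [hF A.1 A.2]
    · rw [Matrix.one_apply_ne hAB, if_neg]
      exact hint A.1 A.2 B.1 B.2 fun h => hAB (Subtype.ext h)
  have h1 : (M * M.transpose).rank = F.card := by
    rw [hone, Matrix.rank_one, Fintype.card_coe]
  have h2 := (Matrix.rank_mul_le_left M M.transpose).trans (Matrix.rank_le_card_width M)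
  rw [h1, Fintype.card_coe, card_powersetCard, card_univ, Fintype.card_fin] at h2
  exact h2

/-- If every set of more than `m` of the points `φ a` contains a pair realising the diameter,
then parts of smaller diameter contain at most `m` of them. -/
theorem not_hasBorsukPartition {X α : Type*} [MetricSpace X] (T : Finset α) (φ : α → X)
    (S : Set X) (hS : Bornology.IsBounded S) (hφ : ∀ a ∈ T, φ a ∈ S) (m k : ℕ)
    (hm : ∀ F ⊆ T, m < F.card → ∃ a ∈ F, ∃ b ∈ F, Metric.diam S ≤ dist (φ a) (φ b))
    (hk : k * m < T.card) : ¬ HasBorsukPartition S k := by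
  classical
  rintro ⟨P, hP, -, hdiam⟩
  have hsub : ∀ i, P i ⊆ S := fun i => hP ▸ Set.subset_iUnion P i
  have hcover : ∀ a ∈ T, ∃ i, φ a ∈ P i := fun a ha => by
    have := hφ a ha
    rwa [← hP, Set.mem_iUnion] at this
  have : Nonempty (Fin k) := by
    obtain ⟨a, ha⟩ := Finset.card_pos.1 (Nat.zero_lt_of_lt hk)
    exact ⟨(hcover a ha).choose⟩
  choose! f hf using hcover
  obtain ⟨i, -, hi⟩ := Finset.exists_lt_card_fiber_of_mul_lt_card_of_maps_to
    (t := Finset.univ) (f := f) (fun a _ => Finset.mem_univ _) (by simpa using hk)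
  obtain ⟨a, ha, b, hb, hab⟩ := hm _ (Finset.filter_subset _ _) hi
  rw [Finset.mem_filter] at ha hb
  have h1 : dist (φ a) (φ b) ≤ Metric.diam (P i) :=
    Metric.dist_le_diam_of_mem (hS.subset (hsub i)) (ha.2 ▸ hf a ha.1) (hb.2 ▸ hf b hb.1)
  exact absurd (hdiam i) (not_lt.2 (hab.trans h1))

theorem seven_le_two_rpow {r : ℝ} (hr : 281 / 100 ≤ r) : (7 : ℝ) ≤ 2 ^ r := by
  -- 73/26 is a rational between log₂ 7 and 2.81: `7 ^ 26 ≤ 2 ^ 73`.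
  have h1 : (2 : ℝ) ^ (73 / 26 : ℝ) ≤ 2 ^ r := 
    Real.rpow_le_rpow_of_exponent_le (by norm_num) (by linarith)
  refine le_trans ?_ h1
  refine le_of_pow_le_pow_left₀ (n := 26) (by norm_num) (by positivity) ?_
  rw [← Real.rpow_natCast ((2 : ℝ) ^ (73 / 26 : ℝ)), ← Real.rpow_mul (by norm_num)]
  have : (73 / 26 : ℝ) * ((26 : ℕ) : ℝ) = ((73 : ℕ) : ℝ) := by norm_num
  rw [this, Real.rpow_natCast]
  norm_num

open Finset in
theorem sum_lt_eq_half {n : ℕ} (G : Fin n → Fin n → ℝ) (hG : ∀ i j, G i j = G j i) :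
    2 * ∑ q : {q : Fin n × Fin n // q.1 < q.2}, G q.1.1 q.1.2 =
      (∑ i, ∑ j, G i j) - ∑ i, G i i := by
  have h1 : ∑ q : {q : Fin n × Fin n // q.1 < q.2}, G q.1.1 q.1.2 =
      ∑ i, ∑ j, if i < j then G i j else 0 := by
    rw [← Fintype.sum_prod_type' (f := fun i j => if i < j then G i j else 0), ← sum_filter]
    exact (sum_subtype _ (by simp) (fun q : Fin n × Fin n => G q.1 q.2)).symm
  have h2 : (∑ i, ∑ j, if i < j then G i j else 0) = ∑ i, ∑ j, if j < i then G i j else 0 := by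
    rw [sum_comm]
    simp_rw [hG]
  have h3 : ∑ i, G i i = ∑ i, ∑ j, if i = j then G i j else 0 := by simp
  rw [two_mul, h1]
  nth_rw 2 [h2]
  rw [h3, ← sum_add_distrib, ← sum_sub_distrib]
  refine sum_congr rfl fun i _ => ?_
  rw [← sum_add_distrib, ← sum_sub_distrib]
  refine sum_congr rfl fun j _ => ?_
  rcases lt_trichotomy i j with h | h | h
  · simp [h, h.not_gt, h.ne]
  · simp [h]
  · simp [h, h.not_gt, h.ne']

/-- The value attached to a pair containing `s` elements of a set. -/
noncomputable def pairValue : ℕ → ℝ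
  | 0 => 0
  | 1 => -1
  | _ => 1

/-- The number of elements of the pair `i, j` in `A` (with multiplicity). -/
def pairCount {n : ℕ} (A : Finset (Fin n)) (i j : Fin n) : ℕ :=
  (if i ∈ A then 1 else 0) + (if j ∈ A then 1 else 0)

open Finset in
theorem sum_pairValue {n k h : ℕ} (A B : Finset (Fin n)) (hA : A.card = k) (hB : B.card = k)
    (hAB : (A ∩ B).card + h = k) {r : ℝ} (hr : 0 < r) :
    ∑ q : {q : Fin n × Fin n // q.1 < q.2},
      |pairValue (pairCount A q.1.1 q.1.2) - pairValue (pairCount B q.1.1 q.1.2)| ^ r =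
    h * (h - 1) + 2 * 2 ^ r * h * (k - h) + 2 * h * (n - k - h) := by
  set c : ℝ := 2 ^ r
  let α : Fin n → ℝ := fun i => if i ∈ A \ B then 1 else 0
  let β : Fin n → ℝ := fun i => if i ∈ B \ A then 1 else 0
  let γ : Fin n → ℝ := fun i => if i ∈ A ∩ B then 1 else 0
  let δ : Fin n → ℝ := fun i => 1 - α i - β i - γ i
  have hα : ∑ i, α i = h := by
    have := card_sdiff_add_card_inter A B
    simp only [α, sum_boole, filter_mem_eq_inter, univ_inter]
    congr 1
    omega
  have hβ : ∑ i, β i = h := by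
    have := card_sdiff_add_card_inter B A
    rw [inter_comm] at this
    simp only [β, sum_boole, filter_mem_eq_inter, univ_inter]
    congr 1
    omega
  have hγ : ∑ i, γ i = k - h := by
    simp only [γ, sum_boole, filter_mem_eq_inter, univ_inter]
    rw [← hAB]
    push_cast
    ring
  have hδ : ∑ i, δ i = n - k - h := by
    simp only [δ, sum_sub_distrib, hα, hβ, hγ]
    simp
    ring
  let G : Fin n → Fin n → ℝ := fun i j => |pairValue (pairCount A i j) - pairValue (pairCount B i j)| ^ r
  -- Only counts 1 and 2 differ by 2 in value: one point of the symmetric difference, one of `A ∩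
  -- B`.
  have hG : ∀ i j, G i j = α i * α j + β i * β j + c * (α i + β i) * γ j + c * γ i * (α j + β j)
      + (α i + β i) * δ j + δ i * (α j + β j) := by
    intro i j
    have h0 : (0 : ℝ) ^ r = 0 := Real.zero_rpow hr.ne'
    have e2 : |(1 : ℝ) + 1| ^ r = c := by norm_num [c]
    have e3 : |(-1 : ℝ) - 1| ^ r = c := by norm_num [c]
    by_cases a1 : i ∈ A <;> by_cases a2 : j ∈ A <;> by_cases b1 : i ∈ B <;> by_cases b2 : j ∈ B <;>
      simp [G, α, β, γ, δ, pairCount, pairValue, a1, a2, b1, b2, h0, e2, e3]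
  have hsymm : ∀ i j, G i j = G j i := fun i j => by simp only [hG]; ring
  have hdiag : ∑ i, G i i = 2 * h := by
    have : ∀ i, G i i = α i + β i := by
      intro i
      rw [hG]
      by_cases a1 : i ∈ A <;> by_cases b1 : i ∈ B <;> simp [α, β, γ, δ, a1, b1]
    simp only [this, sum_add_distrib, hα, hβ]
    ring
  have hfull : ∑ i, ∑ j, G i j = 2 * h ^ 2 + 4 * c * h * (k - h) + 4 * h * (n - k - h) := by
    simp only [hG, sum_add_distrib, ← mul_sum, ← sum_mul, hα, hβ, hγ, hδ]
    ring
  have := sum_lt_eq_half G hsymm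
  rw [hdiag, hfull] at this
  change ∑ q : {q : Fin n × Fin n // q.1 < q.2}, G q.1.1 q.1.2 = _
  linarith

/-- If more than `k * m` points have mutual distances at most `D`, and any more than `m` of them
include two at distance `D`, then the Borsuk number is more than `k`. -/
theorem lt_borsukNumber {X α : Type*} [MetricSpace X] (T : Finset α) (φ : α → X) (D : ℝ)
    (hD : 0 < D) (hle : ∀ a ∈ T, ∀ b ∈ T, dist (φ a) (φ b) ≤ D) (m k : ℕ)
    (hm : ∀ F ⊆ T, m < F.card → ∃ a ∈ F, ∃ b ∈ F, dist (φ a) (φ b) = D)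
    (hmT : m < T.card) (hk : k * m < T.card) : ((k + 1 : ℕ) : ℕ∞) ≤ borsukNumber X := by
  have hbdd : Bornology.IsBounded (φ '' T) := by
    rw [Metric.isBounded_iff]
    refine ⟨D, ?_⟩
    rintro _ ⟨a, ha, rfl⟩ _ ⟨b, hb, rfl⟩
    exact hle a ha b hb
  have hdiam : Metric.diam (φ '' T) ≤ D := by
    refine Metric.diam_le_of_forall_dist_le hD.le ?_
    rintro _ ⟨a, ha, rfl⟩ _ ⟨b, hb, rfl⟩
    exact hle a ha b hb
  have hnt : (φ '' T).Nontrivial := by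
    obtain ⟨a, ha, b, hb, hab⟩ := hm T subset_rfl hmT
    exact ⟨φ a, ⟨a, ha, rfl⟩, φ b, ⟨b, hb, rfl⟩, dist_pos.1 (hab ▸ hD)⟩
  refine le_sInf ?_
  rintro _ ⟨l, rfl, hl⟩
  by_contra! hlt
  have hlk : l ≤ k := Nat.lt_succ_iff.1 (by exact_mod_cast hlt)
  refine not_hasBorsukPartition T φ _ hbdd (fun a ha => ⟨a, ha, rfl⟩) m l ?_
    ((Nat.mul_le_mul_right m hlk).trans_lt hk) (hl _ hbdd hnt)
  intro F hF hcard
  obtain ⟨a, ha, b, hb, hab⟩ := hm F hF hcard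
  exact ⟨a, ha, b, hb, hab ▸ hdiam⟩

theorem le_borsukNumber_linfty : 422 ≤ borsukNumber (lpSpace ⊤ 406) := by
  let φ : (Fin 9 → Bool) → lpSpace ⊤ 406 := fun u =>
    WithLp.toLp ⊤ fun i => if h : i.1 < 9 then (if u ⟨i.1, h⟩ then 1 else 0) else 0
  have hcoord : ∀ u v i, dist (φ u i) (φ v i) ≤ 1 := by
    intro u v i
    simp only [φ, Real.dist_eq]
    split_ifs <;> simp
  have hle : ∀ u v, dist (φ u) (φ v) ≤ 1 := fun u v => by
    rw [PiLp.dist_eq_iSup]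
    exact ciSup_le (hcoord u v)
  -- All `2 ^ 9 = 512 > 421` cube vertices are at mutual distance 1.
  refine lt_borsukNumber (Finset.univ : Finset (Fin 9 → Bool)) φ 1 one_pos
    (fun u _ v _ => hle u v) 1 421 ?_ (by simp) (by simp)
  intro F _ hF
  obtain ⟨u, hu, v, hv, huv⟩ := Finset.one_lt_card.1 hF
  refine ⟨u, hu, v, hv, le_antisymm (hle u v) ?_⟩
  obtain ⟨j, hj⟩ := Function.ne_iff.1 huv
  rw [PiLp.dist_eq_iSup]
  refine le_ciSup_of_le ⟨1, ?_⟩ (Fin.castLE (by norm_num) j : Fin 406) ?_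
  · rintro _ ⟨i, rfl⟩
    exact hcoord u v i
  · cases hu' : u j <;> cases hv' : v j <;> simp_all [φ, Real.dist_eq]

open Finset in
theorem le_borsukNumber_lp (p : ℝ≥0∞) [Fact (1 ≤ p)] (hr : 281 / 100 ≤ p.toReal) :
    422 ≤ borsukNumber (lpSpace p 406) := by
  set r := p.toReal with hrdef
  have hr0 : 0 < r := by linarith
  set c : ℝ := 2 ^ r with hc
  have hc7 : 7 ≤ c := seven_le_two_rpow hr
  have hcard : Fintype.card {q : Fin 29 × Fin 29 // q.1 < q.2} = 406 := by decide +kernel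
  let e : Fin 406 ≃ {q : Fin 29 × Fin 29 // q.1 < q.2} := (Fintype.equivFinOfCardEq hcard).symm
  let φ : Finset (Fin 29) → lpSpace p 406 := fun A =>
    WithLp.toLp p fun i => pairValue (pairCount A (e i).1.1 (e i).1.2)
  let Q : ℕ → ℝ := fun h => h * (h - 1) + 2 * c * h * (9 - h) + 2 * h * (20 - h)
  have hdist : ∀ A B : Finset (Fin 29), ∀ h, A.card = 9 → B.card = 9 → (A ∩ B).card + h = 9 →
      dist (φ A) (φ B) = Q h ^ (1 / r) := by
    intro A B h hA hB hAB
    rw [PiLp.dist_eq_sum hr0]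
    congr 1
    simp only [φ, Real.dist_eq]
    rw [e.sum_comp (fun q => |pairValue (pairCount A q.1.1 q.1.2) -
      pairValue (pairCount B q.1.1 q.1.2)| ^ r), sum_pairValue A B hA hB hAB hr0]
    simp only [Q]
    push_cast
    ring
  have hQ5 : 0 < Q 5 := by
    simp only [Q]
    push_cast
    linarith
  -- The tight case is `h = 6`: `Q 5 - Q 6 = 4 * c - 28`.
  have hQ : ∀ h ≤ 9, 0 ≤ Q h ∧ Q h ≤ Q 5 := by
    intro h hh
    simp only [Q]
    interval_cases h <;> push_cast <;> constructor <;> linarith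
  have hmem : ∀ A ∈ powersetCard 9 (univ : Finset (Fin 29)), A.card = 9 := fun A hA =>
    (mem_powersetCard.1 hA).2
  refine lt_borsukNumber (powersetCard 9 (univ : Finset (Fin 29))) φ (Q 5 ^ (1 / r))
    (Real.rpow_pos_of_pos hQ5 _) ?_ (Nat.choose 29 4) 421 ?_ ?_ ?_
  · intro A hA B hB
    have hle := (card_le_card (inter_subset_left (s₁ := A) (s₂ := B))).trans_eq (hmem A hA)
    rw [hdist A B (9 - (A ∩ B).card) (hmem A hA) (hmem B hB) (by omega)]
    have := hQ (9 - (A ∩ B).card) (by omega)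
    exact Real.rpow_le_rpow this.1 this.2 (by positivity)
  · intro F hF hlt
    by_contra! hne
    refine absurd (card_le_choose_four F (fun A hA => by rw [hmem A (hF hA)]) ?_) (not_le.2 hlt)
    intro A hA B hB hAB hmod
    have hA9 := hmem A (hF hA)
    have hB9 := hmem B (hF hB)
    have hle := (card_le_card (inter_subset_left (s₁ := A) (s₂ := B))).trans_eq hA9
    -- Among 0, ..., 9 only 4 and 9 are 4 mod 5.
    have h9 : (A ∩ B).card ≠ 9 := fun h => hAB <|
      (eq_of_subset_of_card_le inter_subset_left (by omega)).symm.trans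
        (eq_of_subset_of_card_le inter_subset_right (by omega))
    exact hne A hA B hB (hdist A B 5 hA9 hB9 (by omega))
  · rw [card_powersetCard, card_univ, Fintype.card_fin]
    norm_num [Nat.choose]
  · rw [card_powersetCard, card_univ, Fintype.card_fin]
    norm_num [Nat.choose]

theorem corollary2 (p : ℝ≥0∞) [Fact (1 ≤ p)] (hp : 281 / 100 ≤ p) :
    422 ≤ borsukNumber (lpSpace p 406) := by
  by_cases htop : p = ⊤
  · subst htop
    exact le_borsukNumber_linfty
  · refine le_borsukNumber_lp p ?_
    have := ENNReal.toReal_mono htop hp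
    simpa using this
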